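/- A \emph{binary tree} is either empty or a root node with a left and a right binary subtree; its size is its number of nodes. The \emph{Tamari order} on binary trees is the reflexive and transitive closure of right rotation, where a right rotation replaces, at some node $y$ having a left child $x$, the subtree $y(x(A,B),C)$ by $x(A,y(B,C))$; here $x(A,B)$ denotes the tree with root $x$, left subtree $A$ and right subtree $B$. Label the nodes of a binary tree $T$ of size $n$ by $1,\dots,n$ so that it becomes a binary search tree (infix order). The \emph{final forest} of $T$ is the ordered forest $F$ with $n$ nodes such that, when its nodes are labelled $1,\dots,n$ in preorder (each root first, then its children's subtrees from left to right), for all $a,b$: $b$ is a proper descendant of $a$ in $F$ if and only if $b>a$ and $a$ is a proper ancestor of $b$ in $T$ (equivalently, $b$ lies in the right subtree of $a$ in $T$). Let $F$ be a finite ordered forest of rooted ordered trees. A \emph{flow} on $F$ is an assignment of an integer input $i\ge -1$ to each node of $F$ such that the outgoing rate of every node is $\ge 0$, where the outgoing rate of a node is its own input plus the sum of the outgoing rates of its children. The flow is \emph{closed} if the sum of the outgoing rates of the roots is $0$. \textbf{Theorem.} For every ordered forest $F$ there is a unique binary tree $T(F)$ whose final forest is $F$. The number of closed flows on $F$ and the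 number of binary trees smaller than or equal to $T(F)$ in the Tamari order are both finite, and they are equal. -/

import Mathlib

namespace TamariFlow

/-! ### Rooted ordered trees and ordered forests -/

/-- Rooted ordered trees with a value of type `α` attached to each node: a root, carrying a value,
together with the ordered list of its child subtrees. -/
inductive OrdTree (α : Type) : Type
  | node (value : α) (children : List (OrdTree α)) : OrdTree α

/-- Ordered forests: finite ordered lists of rooted ordered trees. Plain (undecorated) forests are
`OrdForest Unit`. -/
abbrev OrdForest (α : Type) : Type := List (OrdTree α)

mutual
/-- The number of nodes of a tree. -/
def OrdTree.size {α : Type} : OrdTree α → ℕ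
  | .node _ ts => forestSize ts + 1
/-- The number of nodes of a forest. -/
def forestSize {α : Type} : List (OrdTree α) → ℕ
  | [] => 0
  | t :: ts => t.size + forestSize ts
end

mutual
/-- The underlying plain tree, obtained by forgetting the values at the nodes. -/
def OrdTree.shape {α : Type} : OrdTree α → OrdTree Unit
  | .node _ ts => .node () (forestShape ts)
/-- The underlying plain forest, obtained by forgetting the values at the nodes. -/
def forestShape {α : Type} : List (OrdTree α) → List (OrdTree Unit)
  | [] => []
  | t :: ts => t.shape :: forestShape ts
end

/-! ### Flows: a choice of inputs on `F` is a forest with integer values and underlying plain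
forest `F`. -/

mutual
/-- The outgoing rate of the root of a tree whose nodes carry integer inputs: its own input plus
the outgoing rates of its children. -/
def OrdTree.rate : OrdTree ℤ → ℤ
  | .node i ts => i + exitRate ts
/-- The sum of the outgoing rates of the roots of a forest. -/
def exitRate : List (OrdTree ℤ) → ℤ
  | [] => 0
  | t :: ts => t.rate + exitRate ts
end

mutual
/-- Every node of the tree has input at least `-1` and nonnegative outgoing rate. -/
def OrdTree.Admissible : OrdTree ℤ → Prop
  | .node i ts => -1 ≤ i ∧ 0 ≤ (OrdTree.node i ts).rate ∧ ForestAdmissible ts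
/-- Every node of the forest has input at least `-1` and nonnegative outgoing rate. -/
def ForestAdmissible : List (OrdTree ℤ) → Prop
  | [] => True
  | t :: ts => t.Admissible ∧ ForestAdmissible ts
end

/-- `f` is a flow on the forest `F`. -/
def IsFlow (F : OrdForest Unit) (f : OrdForest ℤ) : Prop :=
  forestShape f = F ∧ ForestAdmissible f

/-- The set of closed flows (flows with exit rate `0`) on `F`. -/
def closedFlows (F : OrdForest Unit) : Set (OrdForest ℤ) :=
  {f | IsFlow F f ∧ exitRate f = 0}

/-! ### The preorder labelling of a forest and its descendant relation -/

mutual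
/-- Label the nodes of a tree in preorder (the root first, then the child subtrees from left to
right) by `k, k + 1, …`. -/
def OrdTree.preorderFrom : ℕ → OrdTree Unit → OrdTree ℕ
  | k, .node _ ts => .node k (forestPreorderFrom (k + 1) ts)
/-- Label the nodes of a forest in preorder by `k, k + 1, …`. -/
def forestPreorderFrom : ℕ → List (OrdTree Unit) → List (OrdTree ℕ)
  | _, [] => []
  | k, t :: ts => t.preorderFrom k :: forestPreorderFrom (k + t.size) ts
end

mutual
/-- `b` is the label of some node of the tree. -/
def OrdTree.HasLabel (b : ℕ) : OrdTree ℕ → Prop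
  | .node x ts => b = x ∨ ForestHasLabel b ts
/-- `b` is the label of some node of the forest. -/
def ForestHasLabel (b : ℕ) : List (OrdTree ℕ) → Prop
  | [] => False
  | t :: ts => t.HasLabel b ∨ ForestHasLabel b ts
end

mutual
/-- In the tree there is a node labelled `a` having a proper descendant labelled `b`. -/
def OrdTree.Desc (b a : ℕ) : OrdTree ℕ → Prop
  | .node x ts => (a = x ∧ ForestHasLabel b ts) ∨ ForestDesc b a ts
/-- In the forest there is a node labelled `a` having a proper descendant labelled `b`. -/
def ForestDesc (b a : ℕ) : List (OrdTree ℕ) → Prop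
  | [] => False
  | t :: ts => t.Desc b a ∨ ForestDesc b a ts
end

/-! ### Binary trees, their binary search labelling, and the final forest -/

/-- Label the internal nodes of a binary tree in infix order by `k, k + 1, …`. For `k = 1` this is
the unique labelling by `1, …, n` making it a binary search tree. -/
def searchLabelFrom : ℕ → BinaryTree Unit → BinaryTree ℕ
  | _, .nil => .nil
  | k, .node _ L R =>
      .node (k + L.numNodes) (searchLabelFrom k L) (searchLabelFrom (k + L.numNodes + 1) R)

/-- `b` is the label of some node of the binary tree. -/
def TreeHasLabel (b : ℕ) : BinaryTree ℕ → Prop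
  | .nil => False
  | .node x L R => b = x ∨ TreeHasLabel b L ∨ TreeHasLabel b R

/-- The order relation of a labelled binary tree: `b` precedes `a` if there is a node labelled `a`
which is a proper ancestor of a node labelled `b`. -/
def Precedes (b a : ℕ) : BinaryTree ℕ → Prop
  | .nil => False
  | .node x L R =>
      (a = x ∧ (TreeHasLabel b L ∨ TreeHasLabel b R)) ∨ Precedes b a L ∨ Precedes b a R

/-- `F` is the final forest of the binary tree `T`: both have the same number of nodes and, when
`F` is labelled in preorder and `T` is labelled as a binary search tree, both with `1, …, n`, the
(descendant) order of `F` consists exactly of the decreasing relations of `T`, that is, of the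
relations "`b` precedes `a`" with `b > a`. -/
def IsFinalForest (T : BinaryTree Unit) (F : OrdForest Unit) : Prop :=
  forestSize F = T.numNodes ∧
    ∀ a b : ℕ, ForestDesc b a (forestPreorderFrom 1 F) ↔
      (a < b ∧ Precedes b a (searchLabelFrom 1 T))

/-! ### The Tamari order -/

/-- `RightRotation S T`: the binary tree `T` is obtained from `S` by one right rotation
`y(x(A, B), C) → x(A, y(B, C))`, performed at some node `y` of `S`. -/
inductive RightRotation : BinaryTree Unit → BinaryTree Unit → Prop
  | root (A B C : BinaryTree Unit) :
      RightRotation (.node () (.node () A B) C) (.node () A (.node () B C))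
  | left {L L' : BinaryTree Unit} (R : BinaryTree Unit) (h : RightRotation L L') :
      RightRotation (.node () L R) (.node () L' R)
  | right (L : BinaryTree Unit) {R R' : BinaryTree Unit} (h : RightRotation R R') :
      RightRotation (.node () L R) (.node () L R')

/-- The Tamari order: the reflexive and transitive closure of right rotation. -/
def TamariLE : BinaryTree Unit → BinaryTree Unit → Prop :=
  Relation.ReflTransGen RightRotation

end TamariFlow

namespace TamariFlow

/-! ### Concatenation of forests -/

-- Cutting off the last tree of a forest matches cutting a binary tree at its root: `forestOf` turns
-- the left subtree into the preceding trees and the right subtree into the children of the last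
-- root. Preorder and infix labels then agree, so `forestOf T` is the final forest of `T`.
--
-- Equality of the two counts needs a refinement that survives induction (`card_flows`): the flows
-- on `forestOf T` with exit rate `k` number the sum, over `S` below `T`, of `multichoose
-- (leftBorder S) k`. At `k = 0` every summand is 1.
--
-- For `T` with subtrees `L` and `R`, the trees below `T` are uniquely `insertLeft A B j` with `A ≤
-- L`, `B ≤ R`, `j ≤ leftBorder B`, and the left border becomes `leftBorder A + (j + 1)`. A flow
-- splits into a flow on each part; the children of the last root, of rate `j`, may emit any `l ≤ j
-- + 1`. The two recursions agree by Vandermonde and two hockey-stick identities for `multichoose`.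

theorem forestSize_append {α : Type} (f g : List (OrdTree α)) :
    forestSize (f ++ g) = forestSize f + forestSize g := by
  induction f with
  | nil => simp [forestSize]
  | cons t f ih => simp [forestSize, ih, add_assoc]

theorem forestShape_eq_map {α : Type} (f : List (OrdTree α)) :
    forestShape f = f.map OrdTree.shape := by
  induction f with
  | nil => simp [forestShape]
  | cons t f ih => simp [forestShape, ih]

theorem exitRate_append (f g : List (OrdTree ℤ)) :
    exitRate (f ++ g) = exitRate f + exitRate g := by
  induction f with
  | nil => simp [exitRate]
  | cons t f ih => simp [exitRate, ih, add_assoc]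

theorem forestAdmissible_append (f g : List (OrdTree ℤ)) :
    ForestAdmissible (f ++ g) ↔ ForestAdmissible f ∧ ForestAdmissible g := by
  induction f with
  | nil => simp [ForestAdmissible]
  | cons t f ih => simp [ForestAdmissible, ih, and_assoc]

theorem forestPreorderFrom_append (k : ℕ) (f g : List (OrdTree Unit)) :
    forestPreorderFrom k (f ++ g) =
      forestPreorderFrom k f ++ forestPreorderFrom (k + forestSize f) g := by
  induction f generalizing k with
  | nil => simp [forestPreorderFrom, forestSize]
  | cons t f ih => simp [forestPreorderFrom, forestSize, ih, add_assoc]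

theorem forestHasLabel_append (b : ℕ) (f g : List (OrdTree ℕ)) :
    ForestHasLabel b (f ++ g) ↔ ForestHasLabel b f ∨ ForestHasLabel b g := by
  induction f with
  | nil => simp [ForestHasLabel]
  | cons t f ih => simp [ForestHasLabel, ih, or_assoc]

theorem forestDesc_append (b a : ℕ) (f g : List (OrdTree ℕ)) :
    ForestDesc b a (f ++ g) ↔ ForestDesc b a f ∨ ForestDesc b a g := by
  induction f with
  | nil => simp [ForestDesc]
  | cons t f ih => simp [ForestDesc, ih, or_assoc]

/-! ### The forest of a binary tree -/

/-- The forest whose last tree has as children the forest of the right subtree, preceded by the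
forest of the left subtree. -/
def forestOf : BinaryTree Unit → OrdForest Unit
  | .nil => []
  | .node _ L R => forestOf L ++ [.node () (forestOf R)]

theorem forestSize_forestOf (T : BinaryTree Unit) : forestSize (forestOf T) = T.numNodes := by
  induction T with
  | nil => simp [forestOf, forestSize]
  | node _ L R ihL ihR =>
    simp [forestOf, forestSize_append, forestSize, OrdTree.size, ihL, ihR, add_assoc]

theorem forestOf_surjective : Function.Surjective forestOf := by
  suffices h : ∀ n : ℕ, ∀ F : OrdForest Unit, forestSize F = n → ∃ T, forestOf T = F from
    fun F => h _ F rfl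
  intro n
  induction n using Nat.strong_induction_on with
  | _ n ih =>
    intro F hF
    rcases List.eq_nil_or_concat F with rfl | ⟨F', ⟨⟨⟩, G⟩, rfl⟩
    · exact ⟨.nil, rfl⟩
    · simp only [List.concat_eq_append, forestSize_append, forestSize, OrdTree.size] at hF
      obtain ⟨L, rfl⟩ := ih (forestSize F') (by omega) F' rfl
      obtain ⟨R, rfl⟩ := ih (forestSize G) (by omega) G rfl
      exact ⟨.node () L R, by simp [forestOf]⟩

/-! ### Descendants in the final forest -/

theorem treeHasLabel_searchLabelFrom (b k : ℕ) (T : BinaryTree Unit) :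
    TreeHasLabel b (searchLabelFrom k T) ↔ k ≤ b ∧ b < k + T.numNodes := by
  induction T generalizing k with
  | nil => simp [searchLabelFrom, TreeHasLabel]
  | node _ L R ihL ihR =>
    simp only [searchLabelFrom, TreeHasLabel, BinaryTree.numNodes, ihL, ihR]; omega

theorem forestHasLabel_forestOf (b k : ℕ) (T : BinaryTree Unit) :
    ForestHasLabel b (forestPreorderFrom k (forestOf T)) ↔ k ≤ b ∧ b < k + T.numNodes := by
  induction T generalizing k with
  | nil => simp [forestOf, forestPreorderFrom, ForestHasLabel]
  | node _ L R ihL ihR =>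
    simp only [forestOf, forestPreorderFrom_append, forestHasLabel_append, forestPreorderFrom,
      OrdTree.preorderFrom, ForestHasLabel, OrdTree.HasLabel, BinaryTree.numNodes, ihL, ihR,
      forestSize_forestOf, or_false]
    omega

/-- The decreasing relations of `T` labelled from `k`. -/
def DecRel (k : ℕ) (T : BinaryTree Unit) (a b : ℕ) : Prop :=
  a < b ∧ Precedes b a (searchLabelFrom k T)

theorem precedes_bounds {k a b : ℕ} {T : BinaryTree Unit}
    (h : Precedes b a (searchLabelFrom k T)) :
    (k ≤ a ∧ a < k + T.numNodes) ∧ k ≤ b ∧ b < k + T.numNodes := by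
  induction T generalizing k with
  | nil => simp [searchLabelFrom, Precedes] at h
  | node _ L R ihL ihR =>
    simp only [searchLabelFrom, Precedes, treeHasLabel_searchLabelFrom] at h
    simp only [BinaryTree.numNodes]
    rcases h with ⟨rfl, h⟩ | h | h
    · omega
    · have := ihL h; omega
    · have := ihR h; omega

theorem not_decRel_nil (k a b : ℕ) : ¬ DecRel k .nil a b := by
  simp [DecRel, searchLabelFrom, Precedes]

theorem decRel_node (k a b : ℕ) (L R : BinaryTree Unit) :
    DecRel k (.node () L R) a b ↔
      (a = k + L.numNodes ∧ a < b ∧ b < k + L.numNodes + 1 + R.numNodes) ∨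
        DecRel k L a b ∨ DecRel (k + L.numNodes + 1) R a b := by
  simp only [DecRel, searchLabelFrom, Precedes, treeHasLabel_searchLabelFrom]
  constructor
  · rintro ⟨h, h' | h' | h'⟩
    · left; omega
    · exact .inr (.inl ⟨h, h'⟩)
    · exact .inr (.inr ⟨h, h'⟩)
  · rintro (h | ⟨h, h'⟩ | ⟨h, h'⟩)
    · exact ⟨h.2.1, .inl (by omega)⟩
    · exact ⟨h, .inr (.inl h')⟩
    · exact ⟨h, .inr (.inr h')⟩

/-- The forest of `L` takes the first `L.numNodes` labels, then comes the last root, then its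
descendants: exactly the infix order of the tree. -/
theorem forestDesc_forestOf (k a b : ℕ) (T : BinaryTree Unit) :
    ForestDesc b a (forestPreorderFrom k (forestOf T)) ↔ DecRel k T a b := by
  induction T generalizing k with
  | nil => simp [forestOf, forestPreorderFrom, ForestDesc, not_decRel_nil]
  | node _ L R ihL ihR =>
    rw [decRel_node]
    simp only [forestOf, forestPreorderFrom_append, forestDesc_append, forestPreorderFrom,
      OrdTree.preorderFrom, ForestDesc, OrdTree.Desc, ihL, ihR, forestSize_forestOf,
      forestHasLabel_forestOf, or_false]
    constructor
    · rintro (h | h | h)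
      · exact .inr (.inl h)
      · left; omega
      · exact .inr (.inr h)
    · rintro (h | h | h)
      · exact .inr (.inl (by omega))
      · exact .inl h
      · exact .inr (.inr h)

theorem isFinalForest_forestOf (T : BinaryTree Unit) : IsFinalForest T (forestOf T) :=
  ⟨forestSize_forestOf T, fun a b => forestDesc_forestOf 1 a b T⟩

/-- The root has the smallest label among the nodes all of whose successors are descendants. -/
theorem numNodes_left_le_of_decRel_imp {k : ℕ} {L R L' R' : BinaryTree Unit}
    (hn : (BinaryTree.node () L R).numNodes = (BinaryTree.node () L' R').numNodes)
    (h : ∀ a b, DecRel k (.node () L' R') a b → DecRel k (.node () L R) a b) :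
    L.numNodes ≤ L'.numNodes := by
  simp only [BinaryTree.numNodes] at hn
  by_contra! hlt
  -- If `L'` were smaller, the root label of the first tree would lie in the right subtree of a node
  -- of that tree, hence have a proper ancestor.
  have h1 := h (k + L'.numNodes) (k + L.numNodes)
    ((decRel_node ..).2 (.inl ⟨rfl, by omega, by omega⟩))
  rcases (decRel_node ..).1 h1 with h2 | h2 | h2
  · omega
  · have := precedes_bounds h2.2; omega
  · have := precedes_bounds h2.2; omega

/-- The relations and the size determine the root label. The relations then split between the
subtrees according to whether `a` is below or above that label. -/
theorem eq_of_decRel_iff {k : ℕ} {T T' : BinaryTree Unit} (hn : T.numNodes = T'.numNodes)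
    (h : ∀ a b, DecRel k T a b ↔ DecRel k T' a b) : T = T' := by
  induction T generalizing k T' with
  | nil =>
    cases T' with
    | nil => rfl
    | node _ L' R' => simp [BinaryTree.numNodes] at hn
  | node _ L R ihL ihR =>
    cases T' with
    | nil => simp [BinaryTree.numNodes] at hn
    | node _ L' R' =>
      have hL : L.numNodes = L'.numNodes :=
        le_antisymm (numNodes_left_le_of_decRel_imp hn fun a b => (h a b).2)
          (numNodes_left_le_of_decRel_imp hn.symm fun a b => (h a b).1)
      have hR : R.numNodes = R'.numNodes := by
        simp only [BinaryTree.numNodes] at hn; omega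
      have key : ∀ a b, (DecRel k L a b ↔ DecRel k L' a b) ∧
          (DecRel (k + L.numNodes + 1) R a b ↔ DecRel (k + L.numNodes + 1) R' a b) := by
        intro a b
        have h0 := h a b
        rw [decRel_node, decRel_node, ← hL, ← hR] at h0
        have b1 : DecRel k L a b → a < k + L.numNodes := fun h => (precedes_bounds h.2).1.2
        have b2 : DecRel k L' a b → a < k + L.numNodes := fun h =>
          hL ▸ (precedes_bounds h.2).1.2
        have b3 : DecRel (k + L.numNodes + 1) R a b → k + L.numNodes + 1 ≤ a := fun h =>
          (precedes_bounds h.2).1.1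
        have b4 : DecRel (k + L.numNodes + 1) R' a b → k + L.numNodes + 1 ≤ a := fun h =>
          (precedes_bounds h.2).1.1
        grind
      rw [ihL hL fun a b => (key a b).1, ihR hR fun a b => (key a b).2]

theorem isFinalForest_unique {T T' : BinaryTree Unit} {F : OrdForest Unit}
    (h : IsFinalForest T F) (h' : IsFinalForest T' F) : T = T' :=
  eq_of_decRel_iff (h.1.symm.trans h'.1) fun a b => (h.2 a b).symm.trans (h'.2 a b)

/-! ### The lower ideals of the Tamari order -/

/-- The number of nodes on the left border of a binary tree. -/
def leftBorder : BinaryTree Unit → ℕ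
  | .nil => 0
  | .node _ L _ => leftBorder L + 1

/-- Insert a node with left subtree `A` on the left border of `B`, below the first `j` nodes of
this border; what was there becomes its right subtree. -/
def insertLeft (A : BinaryTree Unit) : BinaryTree Unit → ℕ → BinaryTree Unit
  | B, 0 => .node () A B
  | .nil, _ + 1 => .node () A .nil
  | .node _ B₁ B₂, j + 1 => .node () (insertLeft A B₁ j) B₂

theorem insertLeft_zero (A B : BinaryTree Unit) : insertLeft A B 0 = .node () A B := by
  cases B <;> rfl

theorem leftBorder_insertLeft {A B : BinaryTree Unit} {j : ℕ} (hj : j ≤ leftBorder B) :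
    leftBorder (insertLeft A B j) = leftBorder A + (j + 1) := by
  induction j generalizing B with
  | zero => simp [insertLeft, leftBorder]
  | succ j ih =>
    cases B with
    | nil => simp [leftBorder] at hj
    | node _ B₁ B₂ =>
      simp only [leftBorder] at hj
      simp only [insertLeft, leftBorder, ih (Nat.le_of_succ_le_succ hj)]
      omega

theorem numNodes_insertLeft (A B : BinaryTree Unit) (j : ℕ) :
    (insertLeft A B j).numNodes = A.numNodes + B.numNodes + 1 := by
  induction j generalizing B with
  | zero => simp [insertLeft, BinaryTree.numNodes]
  | succ j ih =>
    cases B with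
    | nil => simp [insertLeft, BinaryTree.numNodes]
    | node _ B₁ B₂ => simp only [insertLeft, BinaryTree.numNodes, ih]; omega

/-- The left subtree of the root has `A.numNodes` nodes if `j = 0` and more otherwise, so fixing the
size of `A` makes `j` recoverable. -/
theorem insertLeft_inj {A A' B B' : BinaryTree Unit} {j j' : ℕ}
    (hA : A.numNodes = A'.numNodes) (hj : j ≤ leftBorder B) (hj' : j' ≤ leftBorder B')
    (h : insertLeft A B j = insertLeft A' B' j') : A = A' ∧ B = B' ∧ j = j' := by
  induction j generalizing B B' j' with
  | zero =>
    cases j' with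
    | zero =>
      simp only [insertLeft, BinaryTree.node.injEq, true_and] at h
      exact ⟨h.1, h.2, rfl⟩
    | succ j' =>
      cases B' with
      | nil => simp [leftBorder] at hj'
      | node _ B₁ B₂ =>
        simp only [insertLeft, BinaryTree.node.injEq, true_and] at h
        have := numNodes_insertLeft A' B₁ j'
        rw [← h.1] at this
        omega
  | succ j ih =>
    cases B with
    | nil => simp [leftBorder] at hj
    | node _ B₁ B₂ =>
      cases j' with
      | zero =>
        simp only [insertLeft, BinaryTree.node.injEq, true_and] at h
        have := numNodes_insertLeft A B₁ j
        rw [h.1] at this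
        omega
      | succ j' =>
        cases B' with
        | nil => simp [leftBorder] at hj'
        | node _ B₁' B₂' =>
          simp only [leftBorder, add_le_add_iff_right] at hj hj'
          simp only [insertLeft, BinaryTree.node.injEq, true_and] at h
          obtain ⟨h1, h2, h3⟩ := ih hj hj' h.1
          exact ⟨h1, by rw [h2, h.2], by rw [h3]⟩

theorem RightRotation.numNodes_eq {S T : BinaryTree Unit} (h : RightRotation S T) :
    S.numNodes = T.numNodes := by
  induction h with
  | root A B C => simp only [BinaryTree.numNodes]; omega
  | left R h ih => simp only [BinaryTree.numNodes, ih]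
  | right L h ih => simp only [BinaryTree.numNodes, ih]

theorem TamariLE.numNodes_eq {S T : BinaryTree Unit} (h : TamariLE S T) :
    S.numNodes = T.numNodes := by
  induction h with
  | refl => rfl
  | tail _ h ih => exact ih.trans h.numNodes_eq

theorem TamariLE.node {L L' R R' : BinaryTree Unit} (hL : TamariLE L L') (hR : TamariLE R R') :
    TamariLE (.node () L R) (.node () L' R') :=
  (Relation.ReflTransGen.lift (fun X => BinaryTree.node () X R)
      (fun _ _ h => RightRotation.left R h) _ _ hL).trans
    (Relation.ReflTransGen.lift (fun X => BinaryTree.node () L' X)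
      (fun _ _ h => RightRotation.right L' h) _ _ hR)

/-- Each rotation lifts the inserted node one step up the left border. -/
theorem insertLeft_le (A B : BinaryTree Unit) (j : ℕ) :
    TamariLE (insertLeft A B j) (.node () A B) := by
  induction j generalizing B with
  | zero => rw [insertLeft_zero]; exact .refl
  | succ j ih =>
    cases B with
    | nil => exact .refl
    | node _ B₁ B₂ =>
      exact Relation.ReflTransGen.tail (TamariLE.node (ih B₁) .refl) (.root A B₁ B₂)

/-- Undoing a rotation inside `A` or `B` keeps the shape. Undoing one at the inserted node pushes it
one step down; undoing one on the border above it lengthens that border by one. -/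
theorem RightRotation.exists_insertLeft {S A B : BinaryTree Unit} {j : ℕ}
    (hj : j ≤ leftBorder B) (h : RightRotation S (insertLeft A B j)) :
    ∃ A' B' j', TamariLE A' A ∧ TamariLE B' B ∧ j' ≤ leftBorder B' ∧
      S = insertLeft A' B' j' := by
  induction j generalizing B S with
  | zero =>
    simp only [insertLeft] at h
    cases h with
    | root _ B₁ B₂ =>
      exact ⟨A, .node () B₁ B₂, 1, .refl, .refl, by simp [leftBorder], by simp [insertLeft]⟩
    | left _ h => exact ⟨_, B, 0, .single h, .refl, Nat.zero_le _, (insertLeft_zero ..).symm⟩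
    | right _ h => exact ⟨A, _, 0, .refl, .single h, Nat.zero_le _, (insertLeft_zero ..).symm⟩
  | succ j ih =>
    cases B with
    | nil => simp [leftBorder] at hj
    | node _ B₁ B₂ =>
      simp only [leftBorder, add_le_add_iff_right] at hj
      simp only [insertLeft] at h
      generalize hX : insertLeft A B₁ j = X at h
      cases h with
      | root _ C₁ C₂ =>
        -- The undone rotation adds a border node of `B` above the inserted node, hence `j + 2`.
        refine ⟨A, .node () (.node () B₁ C₁) C₂, j + 2, .refl, .single (.root B₁ C₁ C₂), ?_, ?_⟩
        · simpa [leftBorder] using hj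
        · simp [insertLeft, hX]
      | left _ h =>
        obtain ⟨A', B', j', hA, hB, hj', rfl⟩ := ih hj (hX ▸ h)
        exact ⟨A', .node () B' B₂, j' + 1, hA, hB.node .refl, by simpa [leftBorder] using hj',
          rfl⟩
      | right _ h =>
        exact ⟨A, .node () B₁ _, j + 1, .refl, .single (.right B₁ h),
          by simpa [leftBorder] using hj, by simp [insertLeft, hX]⟩

theorem tamariLE_node_iff {S L R : BinaryTree Unit} :
    TamariLE S (.node () L R) ↔
      ∃ A B j, TamariLE A L ∧ TamariLE B R ∧ j ≤ leftBorder B ∧ S = insertLeft A B j := by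
  constructor
  · intro h
    induction h using Relation.ReflTransGen.head_induction_on with
    | refl => exact ⟨L, R, 0, .refl, .refl, Nat.zero_le _, (insertLeft_zero ..).symm⟩
    | head h _ ih =>
      obtain ⟨A, B, j, hA, hB, hj, rfl⟩ := ih
      obtain ⟨A', B', j', hA', hB', hj', rfl⟩ := h.exists_insertLeft hj
      exact ⟨A', B', j', hA'.trans hA, hB'.trans hB, hj', rfl⟩
  · rintro ⟨A, B, j, hA, hB, -, rfl⟩
    exact (insertLeft_le A B j).trans (hA.node hB)

/-- The finite set of binary trees below `T` in the Tamari order. -/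
def lowerTrees : BinaryTree Unit → Finset (BinaryTree Unit)
  | .nil => {.nil}
  | .node _ L R =>
      ((lowerTrees L ×ˢ lowerTrees R).sigma fun p => Finset.range (leftBorder p.2 + 1)).image
        fun x => insertLeft x.1.1 x.1.2 x.2

theorem mem_lowerTrees {S T : BinaryTree Unit} : S ∈ lowerTrees T ↔ TamariLE S T := by
  induction T generalizing S with
  | nil =>
    simp only [lowerTrees, Finset.mem_singleton]
    constructor
    · rintro rfl; exact .refl
    · intro h
      have := h.numNodes_eq
      cases S with
      | nil => rfl
      | node _ L R => simp [BinaryTree.numNodes] at this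
  | node _ L R ihL ihR =>
    rw [tamariLE_node_iff]
    simp only [lowerTrees, Finset.mem_image, Finset.mem_sigma, Finset.mem_product, ihL, ihR,
      Finset.mem_range, Nat.lt_succ_iff]
    constructor
    · rintro ⟨⟨⟨A, B⟩, j⟩, ⟨⟨hA, hB⟩, hj⟩, rfl⟩
      exact ⟨A, B, j, hA, hB, hj, rfl⟩
    · rintro ⟨A, B, j, hA, hB, hj, rfl⟩
      exact ⟨⟨⟨A, B⟩, j⟩, ⟨⟨hA, hB⟩, hj⟩, rfl⟩

/-- All `A` below `L` have the same size, so `insertLeft_inj` applies and no tree is counted twice.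
-/
theorem sum_lowerTrees_node (w : ℕ → ℕ) (L R : BinaryTree Unit) :
    ∑ S ∈ lowerTrees (.node () L R), w (leftBorder S) =
      ∑ A ∈ lowerTrees L, ∑ B ∈ lowerTrees R,
        ∑ j ∈ Finset.range (leftBorder B + 1), w (leftBorder A + (j + 1)) := by
  rw [lowerTrees, Finset.sum_image, Finset.sum_sigma, Finset.sum_product]
  · refine Finset.sum_congr rfl fun A _ => Finset.sum_congr rfl fun B _ =>
      Finset.sum_congr rfl fun j hj => ?_
    rw [leftBorder_insertLeft (Nat.lt_succ_iff.1 (Finset.mem_range.1 hj))]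
  · rintro ⟨⟨A, B⟩, j⟩ h ⟨⟨A', B'⟩, j'⟩ h' heq
    simp only [Finset.mem_coe, Finset.mem_sigma, Finset.mem_product, Finset.mem_range,
      Nat.lt_succ_iff, mem_lowerTrees] at h h'
    obtain ⟨rfl, rfl, rfl⟩ :=
      insertLeft_inj (h.1.1.numNodes_eq.trans h'.1.1.numNodes_eq.symm) h.2 h'.2 heq
    rfl

/-! ### Flows with a given exit rate -/

theorem exitRate_nonneg {f : List (OrdTree ℤ)} (h : ForestAdmissible f) : 0 ≤ exitRate f := by
  induction f with
  | nil => simp [exitRate]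
  | cons t f ih =>
    obtain ⟨i, ts⟩ := t
    simp only [ForestAdmissible, OrdTree.Admissible] at h
    simpa only [exitRate] using add_nonneg h.1.2.1 (ih h.2)

/-- Here `j` is the rate of the last root and `l` that of its children. The root input is `j - l`,
and `-1 ≤ j - l` reads `l < j + 2`. -/
theorem isFlow_append_node_iff {F G : OrdForest Unit} {f : OrdForest ℤ} {k : ℕ} :
    (IsFlow (F ++ [.node () G]) f ∧ exitRate f = k) ↔
      ∃ i j l : ℕ, i + j = k ∧ l < j + 2 ∧
        ∃ f₁ g, (IsFlow F f₁ ∧ exitRate f₁ = i) ∧ (IsFlow G g ∧ exitRate g = l) ∧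
          f = f₁ ++ [.node (j - exitRate g) g] := by
  constructor
  · rintro ⟨⟨hs, ha⟩, hk⟩
    rw [forestShape_eq_map, List.map_eq_append_iff] at hs
    obtain ⟨f₁, f₂, rfl, h1, h2⟩ := hs
    rw [List.map_eq_singleton_iff] at h2
    obtain ⟨⟨v, g⟩, rfl, h2⟩ := h2
    simp only [OrdTree.shape, OrdTree.node.injEq, true_and] at h2
    simp only [forestAdmissible_append, ForestAdmissible, OrdTree.Admissible, OrdTree.rate,
      and_true] at ha
    obtain ⟨ha, hv, hr, hg⟩ := ha
    simp only [exitRate_append, exitRate, OrdTree.rate, add_zero] at hk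
    obtain ⟨i, hi⟩ := Int.eq_ofNat_of_zero_le (exitRate_nonneg ha)
    obtain ⟨j, hj⟩ := Int.eq_ofNat_of_zero_le hr
    obtain ⟨l, hl⟩ := Int.eq_ofNat_of_zero_le (exitRate_nonneg hg)
    refine ⟨i, j, l, by omega, by omega, f₁, g,
      ⟨⟨by rw [forestShape_eq_map, h1], ha⟩, hi⟩, ⟨⟨h2, hg⟩, hl⟩, ?_⟩
    rw [← hj, add_sub_cancel_right]
  · rintro ⟨i, j, l, hij, hlj, f₁, g, ⟨⟨h1, ha⟩, hi⟩, ⟨⟨h2, hg⟩, hl⟩, rfl⟩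
    refine ⟨⟨?_, ?_⟩, ?_⟩
    · rw [forestShape_eq_map] at h1
      simp [forestShape_eq_map, h1, OrdTree.shape, ← h2]
    · simp only [forestAdmissible_append, ForestAdmissible, OrdTree.Admissible, OrdTree.rate,
        and_true]
      exact ⟨ha, by omega, by omega, hg⟩
    · simp only [exitRate_append, exitRate, OrdTree.rate, add_zero]
      omega

open Classical in
/-- The finite set of flows with exit rate `k` on the forest of a binary tree. -/
noncomputable def flows : BinaryTree Unit → ℕ → Finset (OrdForest ℤ)
  | .nil, k => if k = 0 then {[]} else ∅
  | .node _ L R, k =>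
      ((Finset.HasAntidiagonal.antidiagonal k).sigma fun p =>
          flows L p.1 ×ˢ (Finset.range (p.2 + 2)).biUnion (flows R)).image
        fun x => x.2.1 ++ [.node (x.1.2 - exitRate x.2.2) x.2.2]

theorem mem_flows {T : BinaryTree Unit} {k : ℕ} {f : OrdForest ℤ} :
    f ∈ flows T k ↔ IsFlow (forestOf T) f ∧ exitRate f = k := by
  induction T generalizing k f with
  | nil =>
    simp only [flows, forestOf, IsFlow, forestShape_eq_map, List.map_eq_nil_iff]
    constructor
    · split_ifs with hk
      · rintro h
        obtain rfl := Finset.mem_singleton.1 h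
        simp [ForestAdmissible, exitRate, hk]
      · simp
    · rintro ⟨⟨rfl, -⟩, h⟩
      have : k = 0 := by simpa [exitRate, eq_comm] using h
      simp [this]
  | node _ L R ihL ihR =>
    rw [forestOf, isFlow_append_node_iff]
    simp only [flows, Finset.mem_image, Finset.mem_sigma, Finset.HasAntidiagonal.mem_antidiagonal,
      Finset.mem_product, Finset.mem_biUnion, Finset.mem_range, ihL, ihR]
    constructor
    · rintro ⟨⟨⟨i, j⟩, f₁, g⟩, ⟨hij, hf, l, hl, hg⟩, rfl⟩
      exact ⟨i, j, l, hij, hl, f₁, g, hf, hg, rfl⟩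
    · rintro ⟨i, j, l, hij, hl, f₁, g, hf, hg, rfl⟩
      exact ⟨⟨⟨i, j⟩, f₁, g⟩, ⟨hij, hf, l, hl, hg⟩, rfl⟩

theorem card_flows_node (L R : BinaryTree Unit) (k : ℕ) :
    (flows (.node () L R) k).card =
      ∑ p ∈ Finset.HasAntidiagonal.antidiagonal k,
        (flows L p.1).card * ∑ l ∈ Finset.range (p.2 + 2), (flows R l).card := by
  classical
  rw [flows, Finset.card_image_of_injOn, Finset.card_sigma]
  · refine Finset.sum_congr rfl fun p _ => ?_
    rw [Finset.card_product, Finset.card_biUnion]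
    intro l _ l' _ hne
    refine Finset.disjoint_left.2 fun g hg hg' => hne ?_
    exact_mod_cast (mem_flows.1 hg).2.symm.trans (mem_flows.1 hg').2
  · rintro ⟨⟨i, j⟩, f₁, g⟩ h ⟨⟨i', j'⟩, f₁', g'⟩ h' heq
    simp only [Finset.mem_coe, Finset.mem_sigma, Finset.HasAntidiagonal.mem_antidiagonal, Finset.mem_product]
      at h h'
    have h3 := List.append_inj' heq rfl
    simp only [List.cons.injEq, OrdTree.node.injEq, and_true] at h3
    obtain ⟨rfl, h4, rfl⟩ := h3
    obtain rfl : j = j' := by omega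
    obtain rfl : i = i' := by omega
    rfl

/-! ### Enumeration -/

/-- Vandermonde: a multiset on a disjoint union is a pair of multisets. -/
theorem multichoose_add (a b k : ℕ) :
    (a + b).multichoose k =
      ∑ p ∈ Finset.HasAntidiagonal.antidiagonal k, a.multichoose p.1 * b.multichoose p.2 := by
  induction a generalizing k with
  | zero => cases k <;> simp [Finset.Nat.sum_antidiagonal_succ]
  | succ a iha =>
    induction k with
    | zero => simp
    | succ k ihk =>
      have h := iha (k + 1)
      rw [Finset.Nat.sum_antidiagonal_succ] at h ⊢
      simp only [Nat.multichoose_succ_succ, Nat.multichoose_zero_right, add_mul,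
        Finset.sum_add_distrib] at h ⊢
      rw [← ihk, ← add_assoc, ← h, Nat.add_right_comm a 1 b, Nat.multichoose_succ_succ]

theorem sum_range_multichoose_succ (m k : ℕ) :
    ∑ j ∈ Finset.range (m + 1), (j + 1).multichoose k = (m + 1).multichoose (k + 1) := by
  induction m with
  | zero => simp
  | succ m ih => rw [Finset.sum_range_succ, ih, Nat.multichoose_succ_succ (m + 1) k]

theorem sum_range_multichoose (m k : ℕ) :
    ∑ l ∈ Finset.range (k + 1), m.multichoose l = (m + 1).multichoose k := by
  induction k with
  | zero => simp
  | succ k ih => rw [Finset.sum_range_succ, ih, Nat.multichoose_succ_succ, add_comm]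

theorem card_flows (T : BinaryTree Unit) (k : ℕ) :
    (flows T k).card = ∑ S ∈ lowerTrees T, (leftBorder S).multichoose k := by
  induction T generalizing k with
  | nil => cases k <;> simp [flows, lowerTrees, leftBorder]
  | node _ L R ihL ihR =>
    rw [card_flows_node, sum_lowerTrees_node fun n => n.multichoose k]
    calc
      _ = ∑ p ∈ Finset.HasAntidiagonal.antidiagonal k, ∑ A ∈ lowerTrees L, ∑ B ∈ lowerTrees R,
            (leftBorder A).multichoose p.1 *
              ∑ l ∈ Finset.range (p.2 + 2), (leftBorder B).multichoose l := by
        refine Finset.sum_congr rfl fun p _ => ?_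
        simp_rw [ihL, ihR]
        rw [Finset.sum_comm, Finset.sum_mul_sum]
      _ = _ := by
        rw [Finset.sum_comm]
        refine Finset.sum_congr rfl fun A _ => ?_
        rw [Finset.sum_comm]
        refine Finset.sum_congr rfl fun B _ => ?_
        simp_rw [fun j => multichoose_add (leftBorder A) (j + 1) k]
        rw [Finset.sum_comm]
        refine Finset.sum_congr rfl fun p _ => ?_
        -- With `b = leftBorder B`, both inner sums equal `(b + 1).multichoose (p.2 + 1)`: one sums
        -- over the rate `l`, the other over the position `j`.
        rw [← Finset.mul_sum, sum_range_multichoose, sum_range_multichoose_succ]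

theorem closedFlows_forestOf (T : BinaryTree Unit) :
    closedFlows (forestOf T) = (flows T 0 : Set (OrdForest ℤ)) := by
  ext f
  simp [closedFlows, mem_flows]

theorem setOf_tamariLE (T : BinaryTree Unit) :
    {S : BinaryTree Unit | TamariLE S T} = (lowerTrees T : Set (BinaryTree Unit)) := by
  ext S
  simp [mem_lowerTrees]

end TamariFlow

theorem mainTheorem4 (F : TamariFlow.OrdForest Unit) :
    ∃ T : BinaryTree Unit,
      (TamariFlow.IsFinalForest T F ∧
        ∀ T' : BinaryTree Unit, TamariFlow.IsFinalForest T' F → T' = T) ∧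
      (TamariFlow.closedFlows F).Finite ∧
      {S : BinaryTree Unit | TamariFlow.TamariLE S T}.Finite ∧
      (TamariFlow.closedFlows F).ncard = {S : BinaryTree Unit | TamariFlow.TamariLE S T}.ncard := by
  obtain ⟨T, rfl⟩ := TamariFlow.forestOf_surjective F
  refine ⟨T, ⟨TamariFlow.isFinalForest_forestOf T, fun T' h =>
    TamariFlow.isFinalForest_unique h (TamariFlow.isFinalForest_forestOf T)⟩, ?_⟩
  rw [TamariFlow.closedFlows_forestOf, TamariFlow.setOf_tamariLE, Set.ncard_coe_finset,
    Set.ncard_coe_finset, TamariFlow.card_flows]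
  exact ⟨Finset.finite_toSet _, Finset.finite_toSet _, by simp⟩
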